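/- Let $\hbar>0$. For $k\in\mathbb N=\{0,1,2,\dots\}$ let $$\varphi_k(x)=\frac{1}{(\pi\hbar)^{1/4}\sqrt{2^k k!}}\,H_k\!\left(\frac{x}{\sqrt\hbar}\right)e^{-x^2/(2\hbar)},\qquad x\in\mathbb R,$$ be the $k$-th Hermite function, where $H_k$ is the $k$-th (physicists') Hermite polynomial; equivalently, $\varphi_k$ is the $L^2$-normalized eigenfunction with eigenvalue $\hbar(k+\tfrac12)$ of the harmonic oscillator $-\tfrac{\hbar^2}{2}\frac{d^2}{dx^2}+\tfrac12x^2$ (unique up to a phase). For $\psi:\mathbb R\to\mathbb C$ let $$\mathcal W_\psi(x,\xi)=\frac1{2\pi\hbar}\int_{\mathbb R}e^{i\xi y/\hbar}\,\psi\!\left(x-\tfrac y2\right)\overline{\psi\!\left(x+\tfrac y2\right)}\,dy,\qquad (x,\xi)\in\mathbb R^2,$$ be its Wigner function. Then for all $\alpha,\beta,k\in\mathbb N$ the function $x^{2\alpha}\xi^{2\beta}\,\mathcal W_{\varphi_k}(x,\xi)$ is integrable over $\mathbb R^2$, and $$\int_{\mathbb R^2}x^{2\alpha}\xi^{2\beta}\,\mathcal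 W_{\varphi_k}(x,\xi)\,dx\,d\xi={}_2F_1(\alpha+\beta+1,-k;1;2)\,(-1)^k\,\frac{\hbar^{\alpha+\beta}\,(2\alpha)!\,(2\beta)!}{4^{\alpha+\beta}\,\alpha!\,\beta!},$$ where ${}_2F_1(a,b;c;x)=\sum_{n\ge0}\frac{(a)_n(b)_n}{(c)_n}\frac{x^n}{n!}$ is the Gauss hypergeometric function, with $(a)_n=a(a+1)\cdots(a+n-1)$ (for $b=-k$ the series is a finite sum). -/

import Mathlib

open MeasureTheory

noncomputable section

/-- The `k`-th physicists' Hermite polynomial `H_k(y) = 2^{k/2} He_k(√2 y)`, as a function on `ℝ`,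
where `He_k` is the probabilists' Hermite polynomial `Polynomial.hermite k`. -/
def physHermite (k : ℕ) (y : ℝ) : ℝ :=
  Real.sqrt 2 ^ k * Polynomial.aeval (Real.sqrt 2 * y) (Polynomial.hermite k)

/-- The `k`-th `ħ`-rescaled Hermite function
`φ_k(x) = (πħ)^{-1/4} (2^k k!)^{-1/2} H_k(x/√ħ) e^{-x²/(2ħ)}`, that is, the `L²`-normalized
eigenfunction, with eigenvalue `ħ(k + 1/2)`, of the harmonic oscillator
`-(ħ²/2) d²/dx² + x²/2` on `ℝ`. -/
def hermiteFunction (ħ : ℝ) (k : ℕ) (x : ℝ) : ℂ :=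
  (((Real.pi * ħ) ^ (-(1 / 4) : ℝ) / Real.sqrt (2 ^ k * (k.factorial : ℝ)) *
    physHermite k (x / Real.sqrt ħ) * Real.exp (-x ^ 2 / (2 * ħ)) : ℝ) : ℂ)

/-- The cross-Wigner function of `ψ, φ : ℝ → ℂ` on the phase space `ℝ × ℝ`,
`W(ψ,φ)(q,p) = (2πħ)⁻¹ ∫ e^{ipy/ħ} ψ(q - y/2) conj(φ(q + y/2)) dy`. -/
def crossWigner (ħ : ℝ) (ψ φ : ℝ → ℂ) (z : ℝ × ℝ) : ℂ :=
  (((2 * Real.pi * ħ)⁻¹ : ℝ) : ℂ) *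
    ∫ y : ℝ, Complex.exp (Complex.I * ((z.2 * y / ħ : ℝ) : ℂ)) *
      ψ (z.1 - y / 2) * (starRingEnd ℂ) (φ (z.1 + y / 2))

/-- The Wigner function `W_ψ = W(ψ,ψ)`. -/
def wigner (ħ : ℝ) (ψ : ℝ → ℂ) : ℝ × ℝ → ℂ := crossWigner ħ ψ ψ

end

/-! With `t = y / √(2ħ)`, the Wigner integral of `φ_k` becomes `∫ He_k(t - B) He_k(t + B) e^{iqt -
t²/2} dt`, up to explicit factors, where `B = √2 x/√ħ` and `q = √2 ξ/√ħ`. Integration by parts shows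
that `E(P) = ∫ P e^{iqt - t²/2}` satisfies `E(XP) = E(P') + iq E(P)`. This rule alone determines the
integral from `E(1)` (`map_shiftedHermite_mul_shiftedHermite`), as a polynomial of degree `k` in
`(iq - B)(iq + B) = -2(x² + ξ²)/ħ`. So `wigner_hermiteFunction` is a Laguerre polynomial in `2(x² +
ξ²)/ħ` times a Gaussian. Integrating termwise, `integral_monomial_mul_radial_gaussian` turns the
`n`-th power of `x² + ξ²` into `(α + β + 1)_n ħ^n`, and the resulting finite sum is the terminating
hypergeometric series at 2. -/

/-! ### Shifted Hermite polynomials and functionals on them -/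

open Polynomial in
/-- The translate `He_n(X + b)` of the probabilists' Hermite polynomial, with complex coefficients. -/
noncomputable def shiftedHermite (b : ℂ) (n : ℕ) : ℂ[X] :=
  ((hermite n).map (Int.castRingHom ℂ)).comp (X + C b)

section HermiteAlgebra

open Polynomial

theorem shiftedHermite_zero (b : ℂ) : shiftedHermite b 0 = 1 := by
  simp [shiftedHermite]

theorem derivative_shiftedHermite (b : ℂ) (n : ℕ) :
    derivative (shiftedHermite b n) =
      ((derivative (hermite n)).map (Int.castRingHom ℂ)).comp (X + C b) := by
  simp [shiftedHermite, derivative_comp, derivative_map]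

theorem shiftedHermite_succ (b : ℂ) (n : ℕ) :
    shiftedHermite b (n + 1) =
      (X + C b) * shiftedHermite b n - derivative (shiftedHermite b n) := by
  rw [derivative_shiftedHermite]
  simp [shiftedHermite]

theorem derivative_shiftedHermite_succ (b : ℂ) (n : ℕ) :
    derivative (shiftedHermite b (n + 1)) = ((n + 1 : ℕ) : ℂ) • shiftedHermite b n := by
  induction n with
  | zero => simp [shiftedHermite_succ, shiftedHermite_zero]
  | succ n ih =>
    rw [shiftedHermite_succ b (n + 1), derivative_sub, derivative_mul, ih, derivative_smul]
    have h : derivative (shiftedHermite b n) =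
        (X + C b) * shiftedHermite b n - shiftedHermite b (n + 1) := by
      rw [shiftedHermite_succ]; ring
    rw [h]
    simp only [derivative_add, derivative_X, derivative_C, smul_eq_C_mul]
    push_cast
    simp only [map_add, map_one]
    ring

theorem iterate_derivative_shiftedHermite (b : ℂ) (n j : ℕ) :
    derivative^[j] (shiftedHermite b n) =
      (n.descFactorial j : ℂ) • shiftedHermite b (n - j) := by
  induction j generalizing n with
  | zero => simp
  | succ j ih =>
    rw [Function.iterate_succ_apply]
    cases n with
    | zero => simp [shiftedHermite_zero]
    | succ n =>
      rw [derivative_shiftedHermite_succ, iterate_derivative_smul, ih]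
      rw [Nat.succ_descFactorial_succ, smul_smul, Nat.add_sub_add_right, Nat.cast_mul]

/-- Functionals obeying the Gaussian integration by parts rule turn multiplication by
`He_m(X + b)` into the differential operator `(D + a + b)^m`. -/
theorem map_shiftedHermite_mul (E : ℂ[X] →ₗ[ℂ] ℂ) (a : ℂ)
    (hE : ∀ P, E (X * P) = E (derivative P) + a * E P) (b : ℂ) (m : ℕ) (Q : ℂ[X]) :
    E (shiftedHermite b m * Q) =
      ∑ j ∈ Finset.range (m + 1), (m.choose j : ℂ) * (a + b) ^ (m - j) * E (derivative^[j] Q) := by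
  have key : ∀ Q, E (shiftedHermite b m * Q) =
      E ((((derivative : ℂ[X] →ₗ[ℂ] ℂ[X]) + (a + b) • (1 : Module.End ℂ ℂ[X]) :
        Module.End ℂ ℂ[X]) ^ m) Q) := by
    induction m with
    | zero => intro Q; simp [shiftedHermite_zero]
    | succ m ih =>
      intro Q
      rw [pow_succ, Module.End.mul_apply, ← ih, shiftedHermite_succ]
      have h1 : ((X + C b) * shiftedHermite b m - derivative (shiftedHermite b m)) * Q =
          X * (shiftedHermite b m * Q) + b • (shiftedHermite b m * Q)
            - derivative (shiftedHermite b m) * Q := by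
        rw [smul_eq_C_mul]; ring
      have h2 : shiftedHermite b m * (((derivative : ℂ[X] →ₗ[ℂ] ℂ[X]) +
          (a + b) • (1 : Module.End ℂ ℂ[X]) : Module.End ℂ ℂ[X]) Q) =
          shiftedHermite b m * derivative Q + (a + b) • (shiftedHermite b m * Q) := by
        simp [mul_add]
      -- The derivative of the Hermite factor produced by `hE` cancels the one from the recurrence,
      -- leaving `Q' + (a + b) Q`.
      rw [h1, h2, map_sub, map_add, hE, derivative_mul]
      simp only [map_add, map_smul, smul_eq_mul]
      ring
  rw [key, ((Commute.one_right _).smul_right (a + b)).add_pow, LinearMap.sum_apply, map_sum]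
  refine Finset.sum_congr rfl fun j _ => ?_
  rw [_root_.smul_pow, one_pow, mul_smul_comm, mul_one, ← nsmul_eq_mul']
  rw [LinearMap.smul_apply, map_nsmul, LinearMap.smul_apply, map_smul, Module.End.pow_apply,
    nsmul_eq_mul, smul_eq_mul, mul_assoc]

theorem map_shiftedHermite (E : ℂ[X] →ₗ[ℂ] ℂ) (a : ℂ)
    (hE : ∀ P, E (X * P) = E (derivative P) + a * E P) (b : ℂ) (m : ℕ) :
    E (shiftedHermite b m) = (a + b) ^ m * E 1 := by
  have h := map_shiftedHermite_mul E a hE b m 1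
  rw [mul_one, Finset.sum_range_succ'] at h
  simpa [iterate_derivative_one] using h

/-- Expand `(D + a + b)^k` on the second factor: `D^j` lowers its index to `n = k - j` with
coefficient `k!/n!`, and `E` of what remains is `(a + d)^n E(1)`. -/
theorem map_shiftedHermite_mul_shiftedHermite (E : ℂ[X] →ₗ[ℂ] ℂ) (a : ℂ)
    (hE : ∀ P, E (X * P) = E (derivative P) + a * E P) (b d : ℂ) (k : ℕ) :
    E (shiftedHermite b k * shiftedHermite d k) = E 1 *
      ∑ n ∈ Finset.range (k + 1),
        (k.choose n : ℂ) * (k.factorial / n.factorial) * ((a + b) * (a + d)) ^ n := by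
  rw [map_shiftedHermite_mul E a hE, ← Finset.sum_range_reflect, Finset.mul_sum]
  refine Finset.sum_congr rfl fun n hn => ?_
  have hn : n ≤ k := Nat.lt_succ_iff.mp (Finset.mem_range.mp hn)
  have e1 : k + 1 - 1 - n = k - n := by omega
  have e2 : k - (k - n) = n := by omega
  have h : (k.descFactorial (k - n) : ℂ) = k.factorial / n.factorial := by
    rw [eq_div_iff (by exact_mod_cast n.factorial_ne_zero), mul_comm]
    have := Nat.factorial_mul_descFactorial (Nat.sub_le k n)
    rw [e2] at this
    exact_mod_cast this
  rw [e1, e2, iterate_derivative_shiftedHermite, map_smul, e2, map_shiftedHermite E a hE,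
    Nat.choose_symm hn, h, mul_pow, smul_eq_mul]
  ring

end HermiteAlgebra

/-! ### The oscillating Gaussian functional -/

section GaussianFunctional

open Polynomial

theorem integrable_pow_mul_exp_neg_mul_sq {b : ℝ} (hb : 0 < b) (n : ℕ) :
    Integrable fun x : ℝ => x ^ n * Real.exp (-b * x ^ 2) := by
  have h := integrable_rpow_mul_exp_neg_mul_sq hb (s := n)
    (by have := Nat.cast_nonneg (α := ℝ) n; linarith)
  simpa only [Real.rpow_natCast] using h

theorem integrable_eval_mul_cexp (q : ℝ) (P : ℂ[X]) :
    Integrable fun t : ℝ => P.eval (t : ℂ) * Complex.exp (Complex.I * q * t - t ^ 2 / 2) := by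
  induction P using Polynomial.induction_on' with
  | add P Q hP hQ =>
    refine (hP.add hQ).congr (Filter.Eventually.of_forall fun t => ?_)
    simp only [Pi.add_apply, eval_add, add_mul]
  | monomial n a =>
    have h := ((integrable_pow_mul_exp_neg_mul_sq (b := 1 / 2) (by norm_num) n).ofReal
      (𝕜 := ℂ)).bdd_mul (f := fun t : ℝ => a * Complex.exp ((q * t : ℝ) * Complex.I)) (c := ‖a‖)
      (by fun_prop) (Filter.Eventually.of_forall fun t => by
        rw [norm_mul, Complex.norm_exp_ofReal_mul_I, mul_one])
    refine h.congr (Filter.Eventually.of_forall fun t => ?_)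
    simp only [eval_monomial]
    rw [sub_eq_add_neg, Complex.exp_add]
    simp only [RCLike.ofReal_eq_complex_ofReal]
    push_cast
    rw [show Complex.I * q * t = q * t * Complex.I by ring,
      show -((t : ℂ) ^ 2 / 2) = -(1 / 2) * (t : ℂ) ^ 2 by ring]
    ring

/-- The functional `P ↦ ∫ P(t) e^{iqt - t²/2} dt` on complex polynomials. -/
noncomputable def gaussianFunctional (q : ℝ) : ℂ[X] →ₗ[ℂ] ℂ where
  toFun P := ∫ t : ℝ, P.eval (t : ℂ) * Complex.exp (Complex.I * q * t - t ^ 2 / 2)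
  map_add' P Q := by
    simp only [eval_add, add_mul]
    exact integral_add (integrable_eval_mul_cexp q P) (integrable_eval_mul_cexp q Q)
  map_smul' c P := by
    simp only [eval_smul, smul_eq_mul, mul_assoc, RingHom.id_apply]
    exact integral_const_mul c _

theorem gaussianFunctional_apply (q : ℝ) (P : ℂ[X]) : gaussianFunctional q P =
    ∫ t : ℝ, P.eval (t : ℂ) * Complex.exp (Complex.I * q * t - t ^ 2 / 2) := rfl

/-- The derivative of `P(t) e^{iqt - t²/2}` integrates to zero. -/
theorem gaussianFunctional_X_mul (q : ℝ) (P : ℂ[X]) :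
    gaussianFunctional q (X * P) =
      gaussianFunctional q (derivative P) + Complex.I * q * gaussianFunctional q P := by
  have h : gaussianFunctional q (derivative P + (C (Complex.I * q) - X) * P) = 0 := by
    rw [gaussianFunctional_apply]
    refine integral_eq_zero_of_hasDerivAt_of_integrable
      (f := fun t : ℝ => P.eval (t : ℂ) * Complex.exp (Complex.I * q * t - t ^ 2 / 2))
      (fun t => ?_) (integrable_eval_mul_cexp q _) (integrable_eval_mul_cexp q P)
    have h1 : HasDerivAt (fun z : ℂ => Complex.I * q * z - z ^ 2 / 2)
        (Complex.I * q - t) (t : ℂ) := by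
      have := ((hasDerivAt_id (t : ℂ)).const_mul (Complex.I * q)).sub
        (((hasDerivAt_id (t : ℂ)).pow 2).div_const 2)
      refine this.congr_deriv ?_
      simp
    refine ((P.hasDerivAt (t : ℂ)).mul h1.cexp).comp_ofReal.congr_deriv ?_
    simp only [eval_add, eval_mul, eval_sub, eval_C, eval_X]
    ring
  rw [sub_mul, ← smul_eq_C_mul, map_add, map_sub, map_smul, smul_eq_mul] at h
  linear_combination -h

theorem gaussianFunctional_one (q : ℝ) :
    gaussianFunctional q 1 = ((Real.sqrt (2 * Real.pi) * Real.exp (-q ^ 2 / 2) : ℝ) : ℂ) := by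
  have h := integral_cexp_quadratic (b := -(1 / 2)) (by norm_num) (Complex.I * q) 0
  rw [gaussianFunctional_apply, Complex.ofReal_mul, Real.sqrt_eq_rpow,
    Complex.ofReal_cpow (by positivity), Complex.ofReal_exp]
  convert h using 1
  · congr 1; ext t; rw [eval_one, one_mul]; congr 1; ring
  · congr 2
    · push_cast; ring
    · push_cast; norm_num
    · rw [mul_pow, Complex.I_sq]; push_cast; ring

end GaussianFunctional

/-! ### The Wigner function in Laguerre form -/

section Wigner

open Polynomial in
theorem aeval_neg_hermite (k : ℕ) (y : ℝ) :
    aeval (-y) (hermite k) = (-1) ^ k * aeval y (hermite k) := by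
  have h : ∀ k, (hermite k).comp (-X) = (-1) ^ k * hermite k := by
    intro k
    induction k with
    | zero => simp
    | succ k ih =>
      have hd := congrArg derivative ih
      rw [derivative_comp] at hd
      have h1 : derivative ((-1 : ℤ[X]) ^ k * hermite k) = (-1) ^ k * derivative (hermite k) := by
        rw [derivative_mul, show ((-1 : ℤ[X]) ^ k) = C ((-1) ^ k) by simp, derivative_C]
        simp
      rw [h1, derivative_neg, derivative_X] at hd
      rw [hermite_succ, sub_comp, mul_comp, X_comp, ih, pow_succ]
      linear_combination hd
  have := congrArg (aeval y) (h k)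
  simpa [aeval_comp] using this

open Polynomial in
theorem eval_shiftedHermite_ofReal (b t : ℝ) (k : ℕ) :
    (shiftedHermite b k).eval (t : ℂ) = ((aeval (t + b) (hermite k) : ℝ) : ℂ) := by
  rw [shiftedHermite, eval_comp, eval_add, eval_X, eval_C, ← Complex.ofReal_add, eval_map,
    aeval_def, ← Complex.coe_algebraMap, hom_eval₂]
  congr 1

theorem wigner_hermiteFunction (ħ : ℝ) (hħ : 0 < ħ) (k : ℕ) (z : ℝ × ℝ) :
    wigner ħ (hermiteFunction ħ k) z =
      (((-1) ^ k / (Real.pi * ħ) * Real.exp (-(z.1 ^ 2 + z.2 ^ 2) / ħ) *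
        ∑ n ∈ Finset.range (k + 1),
          (k.choose n : ℝ) / n.factorial * (-2 * (z.1 ^ 2 + z.2 ^ 2) / ħ) ^ n : ℝ) : ℂ) := by
  obtain ⟨x, p⟩ := z
  set r := Real.sqrt ħ with hr
  have hr0 : 0 < r := Real.sqrt_pos.mpr hħ
  have hr2 : r ^ 2 = ħ := Real.sq_sqrt hħ.le
  set s := Real.sqrt 2 with hs
  have hs0 : 0 < s := Real.sqrt_pos.mpr two_pos
  have hs2 : s ^ 2 = 2 := Real.sq_sqrt two_pos.le
  set N := (Real.pi * ħ) ^ (-(1 / 4) : ℝ) / Real.sqrt (2 ^ k * (k.factorial : ℝ)) with hN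
  have hN2 : N ^ 2 * (2 ^ k * k.factorial) * Real.sqrt (Real.pi * ħ) = 1 := by
    have hpos : 0 < Real.pi * ħ := by positivity
    have hk : (0 : ℝ) < 2 ^ k * k.factorial := by positivity
    rw [hN, div_pow, Real.sq_sqrt hk.le, div_mul_cancel₀ _ hk.ne', ← Real.rpow_natCast,
      ← Real.rpow_mul hpos.le, Real.sqrt_eq_rpow, ← Real.rpow_add hpos]
    norm_num
  have hsqrt : s * r * Real.sqrt (2 * Real.pi) = 2 * Real.sqrt (Real.pi * ħ) := by
    rw [Real.sqrt_mul two_pos.le, Real.sqrt_mul Real.pi_pos.le]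
    linear_combination r * Real.sqrt Real.pi * hs2
  -- Here `κ = 1/√(2ħ)`, so that `t = κy` makes the factor `e^{-y²/(4ħ)}` equal to `e^{-t²/2}`.
  set κ := (s * r)⁻¹ with hκ
  set B := s * x / r with hB
  set q := s * p / r with hq
  set G : ℝ → ℂ := fun t => (shiftedHermite ((-B : ℝ) : ℂ) k * shiftedHermite (B : ℂ) k).eval
    (t : ℂ) * Complex.exp (Complex.I * q * t - t ^ 2 / 2) with hG
  have hκ2 : s / (2 * r) = κ := by
    rw [hκ]; field_simp; exact hs2
  have key : ∀ y : ℝ, Complex.exp (Complex.I * ((p * y / ħ : ℝ) : ℂ)) *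
      hermiteFunction ħ k (x - y / 2) * (starRingEnd ℂ) (hermiteFunction ħ k (x + y / 2)) =
      ((N ^ 2 * 2 ^ k * (-1) ^ k * Real.exp (-x ^ 2 / ħ) : ℝ) : ℂ) * G (κ * y) := by
    intro y
    -- The sign reversal here, with the parity of `He_k`, is the source of `(-1)^k`.
    have e1 : s * ((x - y / 2) / r) = -(κ * y + -B) := by
      rw [← hκ2, hB]; field_simp; ring
    have e2 : s * ((x + y / 2) / r) = κ * y + B := by
      rw [← hκ2, hB]; field_simp; ring
    have e3 : Complex.exp (Complex.I * q * ((κ * y : ℝ) : ℂ) - ((κ * y : ℝ) : ℂ) ^ 2 / 2) =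
        Complex.exp (Complex.I * ((p * y / ħ : ℝ) : ℂ)) *
          ((Real.exp (-(κ * y) ^ 2 / 2) : ℝ) : ℂ) := by
      have : q * (κ * y) = p * y / ħ := by
        rw [hq, hκ, ← hr2]; field_simp
      rw [← this, Complex.ofReal_exp, ← Complex.exp_add]
      congr 1
      push_cast
      ring
    have e4 : Real.exp (-(x - y / 2) ^ 2 / (2 * ħ)) * Real.exp (-(x + y / 2) ^ 2 / (2 * ħ)) =
        Real.exp (-x ^ 2 / ħ) * Real.exp (-(κ * y) ^ 2 / 2) := by
      have : κ ^ 2 = 1 / (2 * ħ) := by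
        rw [hκ, inv_pow, mul_pow, hs2, hr2, one_div]
      rw [← Real.exp_add, ← Real.exp_add]
      congr 1
      rw [mul_pow, this]
      field_simp
      ring
    have e5 : (s ^ k) ^ 2 = 2 ^ k := by rw [← pow_mul, mul_comm, pow_mul, hs2]
    simp only [hG]
    rw [e3, Polynomial.eval_mul, eval_shiftedHermite_ofReal, eval_shiftedHermite_ofReal]
    simp only [hermiteFunction, physHermite, ← hr, ← hs, ← hN, Complex.conj_ofReal]
    rw [e1, e2, aeval_neg_hermite, mul_assoc, ← Complex.ofReal_mul]
    rw [show ∀ a b c d e : ℂ, a * (b * c * (d * e)) = d * (a * b * c * e) from by intros; ring]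
    congr 1
    simp only [← Complex.ofReal_mul]
    refine congrArg Complex.ofReal ?_
    set u := Polynomial.aeval (κ * y + -B) (Polynomial.hermite k)
    set v := Polynomial.aeval (κ * y + B) (Polynomial.hermite k)
    linear_combination (N ^ 2 * (s ^ k) ^ 2 * (-1) ^ k * u * v) * e4 +
      (N ^ 2 * (-1) ^ k * u * v * Real.exp (-x ^ 2 / ħ) * Real.exp (-(κ * y) ^ 2 / 2)) * e5
  have hint : ∫ t, G t = gaussianFunctional q 1 *
      ∑ n ∈ Finset.range (k + 1),
        (k.choose n : ℂ) * (k.factorial / n.factorial) *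
          ((Complex.I * q + ((-B : ℝ) : ℂ)) * (Complex.I * q + B)) ^ n :=
    map_shiftedHermite_mul_shiftedHermite (gaussianFunctional q) (Complex.I * q)
      (gaussianFunctional_X_mul q) _ _ k
  have hprod : (Complex.I * q + ((-B : ℝ) : ℂ)) * (Complex.I * q + B) =
      ((-2 * (x ^ 2 + p ^ 2) / ħ : ℝ) : ℂ) := by
    have : -q ^ 2 - B ^ 2 = -2 * (x ^ 2 + p ^ 2) / ħ := by
      rw [hq, hB, div_pow, div_pow, mul_pow, mul_pow, hr2, hs2]; ring
    rw [← this]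
    push_cast
    linear_combination (q : ℂ) ^ 2 * Complex.I_sq
  have hexp : Real.exp (-x ^ 2 / ħ) * Real.exp (-q ^ 2 / 2) =
      Real.exp (-(x ^ 2 + p ^ 2) / ħ) := by
    rw [← Real.exp_add, hq, div_pow, mul_pow, hr2, hs2]
    congr 1
    field_simp
    ring
  simp only [wigner, crossWigner, key]
  rw [integral_const_mul, Measure.integral_comp_mul_left, hint, hprod, gaussianFunctional_one,
    hκ, inv_inv, abs_of_pos (by positivity), Complex.real_smul]
  set w := -2 * (x ^ 2 + p ^ 2) / ħ
  set S := ∑ n ∈ Finset.range (k + 1), (k.choose n : ℝ) / n.factorial * w ^ n with hS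
  have hsum : ∑ n ∈ Finset.range (k + 1), (k.choose n : ℂ) * (k.factorial / n.factorial) *
      (w : ℂ) ^ n = ((k.factorial * S : ℝ) : ℂ) := by
    rw [hS, Finset.mul_sum, Complex.ofReal_sum]
    refine Finset.sum_congr rfl fun n _ => ?_
    push_cast
    ring
  rw [hsum, ← hexp]
  simp only [← Complex.ofReal_mul]
  refine congrArg Complex.ofReal ?_
  have hconst : (2 * Real.pi * ħ)⁻¹ * (N ^ 2 * 2 ^ k * k.factorial *
      (s * r * Real.sqrt (2 * Real.pi))) = 1 / (Real.pi * ħ) := by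
    rw [hsqrt]
    field_simp
    linear_combination hN2
  linear_combination ((-1) ^ k * Real.exp (-x ^ 2 / ħ) * Real.exp (-q ^ 2 / 2) * S) * hconst

end Wigner

/-! ### Gaussian moments in phase space -/

section Moments

theorem integral_pow_two_mul_exp_neg_sq_div (ħ : ℝ) (hħ : 0 < ħ) (α : ℕ) :
    ∫ x : ℝ, x ^ (2 * α) * Real.exp (-ħ⁻¹ * x ^ 2) =
      Real.sqrt (Real.pi * ħ) * (ħ ^ α * ((2 * α).factorial : ℝ) / (4 ^ α * α.factorial)) := by
  have hi := integrable_pow_mul_exp_neg_mul_sq (inv_pos.mpr hħ)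
  induction α with
  | zero => simpa using integral_gaussian ħ⁻¹
  | succ α ih =>
    -- The integrand is the derivative of `x^{2α+1} e^{-x²/ħ}`, which gives the recurrence in `α`.
    have h : ∫ x : ℝ, ((2 * α + 1) * (x ^ (2 * α) * Real.exp (-ħ⁻¹ * x ^ 2)) -
        2 * ħ⁻¹ * (x ^ (2 * (α + 1)) * Real.exp (-ħ⁻¹ * x ^ 2))) = 0 := by
      refine integral_eq_zero_of_hasDerivAt_of_integrable
        (f := fun x : ℝ => x ^ (2 * α + 1) * Real.exp (-ħ⁻¹ * x ^ 2)) (fun x => ?_)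
        (((hi _).const_mul _).sub ((hi _).const_mul _)) (hi _)
      refine ((hasDerivAt_pow (2 * α + 1) x).mul
        ((hasDerivAt_pow 2 x).const_mul (-ħ⁻¹)).exp).congr_deriv ?_
      push_cast
      ring
    rw [integral_sub ((hi _).const_mul _) ((hi _).const_mul _), integral_const_mul,
      integral_const_mul, ih] at h
    have h2 : ((2 * (α + 1)).factorial : ℝ) =
        (2 * α + 2) * ((2 * α + 1) * ((2 * α).factorial : ℝ)) := by
      rw [show 2 * (α + 1) = (2 * α + 1) + 1 by ring, Nat.factorial_succ, Nat.factorial_succ]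
      push_cast
      ring
    have h3 : ((α + 1).factorial : ℝ) = (α + 1) * α.factorial := by
      rw [Nat.factorial_succ]; push_cast; ring
    have hf : (α.factorial : ℝ) ≠ 0 := by positivity
    have hα : (α : ℝ) + 1 ≠ 0 := by positivity
    have key : ∫ x : ℝ, x ^ (2 * (α + 1)) * Real.exp (-ħ⁻¹ * x ^ 2) =
        ħ / 2 * ((2 * α + 1) * (Real.sqrt (Real.pi * ħ) *
          (ħ ^ α * ((2 * α).factorial : ℝ) / (4 ^ α * α.factorial)))) := by
      rw [sub_eq_zero.mp h]
      field_simp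
    rw [key, h2, h3]
    field_simp
    ring

/-- The moment `∫∫ x^{2α} ξ^{2β} e^{-(x²+ξ²)/ħ} dx dξ` in closed form. -/
noncomputable def gaussianMoment (ħ : ℝ) (α β : ℕ) : ℝ :=
  Real.pi * ħ * (ħ ^ (α + β) * ((2 * α).factorial : ℝ) * ((2 * β).factorial : ℝ) /
    (4 ^ (α + β) * (α.factorial : ℝ) * (β.factorial : ℝ)))

/-- Raising `α` multiplies the moment by `ħ(α + 1/2)`, and likewise for `β`. -/
theorem gaussianMoment_succ_add (ħ : ℝ) (α β : ℕ) :
    gaussianMoment ħ (α + 1) β + gaussianMoment ħ α (β + 1) =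
      ħ * ((α : ℝ) + β + 1) * gaussianMoment ħ α β := by
  have h2 : ∀ γ : ℕ, ((2 * (γ + 1)).factorial : ℝ) =
      (2 * γ + 2) * ((2 * γ + 1) * ((2 * γ).factorial : ℝ)) := by
    intro γ
    rw [show 2 * (γ + 1) = (2 * γ + 1) + 1 by ring, Nat.factorial_succ, Nat.factorial_succ]
    push_cast
    ring
  have h3 : ∀ γ : ℕ, ((γ + 1).factorial : ℝ) = (γ + 1) * γ.factorial := by
    intro γ
    rw [Nat.factorial_succ]; push_cast; ring
  have hα : (α.factorial : ℝ) ≠ 0 := by positivity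
  have hβ : (β.factorial : ℝ) ≠ 0 := by positivity
  have hα' : (α : ℝ) + 1 ≠ 0 := by positivity
  have hβ' : (β : ℝ) + 1 ≠ 0 := by positivity
  unfold gaussianMoment
  rw [h2, h3, h2, h3, show α + 1 + β = α + β + 1 by ring, show α + (β + 1) = α + β + 1 by ring]
  field_simp
  ring

/-- Peeling off one factor `x² + ξ²` raises either `α` or `β`. Both terms then carry the same `(α +
β + 2)_n`, so `gaussianMoment_succ_add` supplies the missing Pochhammer factor without polar
coordinates. -/
theorem integral_monomial_mul_radial_gaussian (ħ : ℝ) (hħ : 0 < ħ) (n α β : ℕ) :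
    Integrable (fun z : ℝ × ℝ => z.1 ^ (2 * α) * z.2 ^ (2 * β) * (z.1 ^ 2 + z.2 ^ 2) ^ n *
      Real.exp (-(z.1 ^ 2 + z.2 ^ 2) / ħ)) ∧
    ∫ z : ℝ × ℝ, z.1 ^ (2 * α) * z.2 ^ (2 * β) * (z.1 ^ 2 + z.2 ^ 2) ^ n *
      Real.exp (-(z.1 ^ 2 + z.2 ^ 2) / ħ) =
      (ascPochhammer ℝ n).eval ((α : ℝ) + β + 1) * ħ ^ n * gaussianMoment ħ α β := by
  induction n generalizing α β with
  | zero =>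
    have e : (fun z : ℝ × ℝ => z.1 ^ (2 * α) * z.2 ^ (2 * β) * (z.1 ^ 2 + z.2 ^ 2) ^ 0 *
        Real.exp (-(z.1 ^ 2 + z.2 ^ 2) / ħ)) = fun z : ℝ × ℝ =>
        (z.1 ^ (2 * α) * Real.exp (-ħ⁻¹ * z.1 ^ 2)) *
          (z.2 ^ (2 * β) * Real.exp (-ħ⁻¹ * z.2 ^ 2)) := by
      ext z
      rw [show -(z.1 ^ 2 + z.2 ^ 2) / ħ = -ħ⁻¹ * z.1 ^ 2 + -ħ⁻¹ * z.2 ^ 2 by ring, Real.exp_add]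
      ring
    have hi := integrable_pow_mul_exp_neg_mul_sq (inv_pos.mpr hħ)
    rw [e]
    refine ⟨(hi _).mul_prod (hi _), ?_⟩
    rw [Measure.volume_eq_prod, integral_prod_mul (fun x : ℝ => x ^ (2 * α) *
      Real.exp (-ħ⁻¹ * x ^ 2)) (fun x : ℝ => x ^ (2 * β) * Real.exp (-ħ⁻¹ * x ^ 2)),
      integral_pow_two_mul_exp_neg_sq_div ħ hħ, integral_pow_two_mul_exp_neg_sq_div ħ hħ]
    have hs : Real.sqrt (Real.pi * ħ) * Real.sqrt (Real.pi * ħ) = Real.pi * ħ :=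
      Real.mul_self_sqrt (by positivity)
    simp only [ascPochhammer_zero, Polynomial.eval_one, gaussianMoment]
    rw [mul_mul_mul_comm, hs]
    field_simp
    ring
  | succ n ih =>
    obtain ⟨i1, e1⟩ := ih (α + 1) β
    obtain ⟨i2, e2⟩ := ih α (β + 1)
    have e : (fun z : ℝ × ℝ => z.1 ^ (2 * α) * z.2 ^ (2 * β) * (z.1 ^ 2 + z.2 ^ 2) ^ (n + 1) *
        Real.exp (-(z.1 ^ 2 + z.2 ^ 2) / ħ)) = fun z : ℝ × ℝ =>
        z.1 ^ (2 * (α + 1)) * z.2 ^ (2 * β) * (z.1 ^ 2 + z.2 ^ 2) ^ n *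
          Real.exp (-(z.1 ^ 2 + z.2 ^ 2) / ħ) +
        z.1 ^ (2 * α) * z.2 ^ (2 * (β + 1)) * (z.1 ^ 2 + z.2 ^ 2) ^ n *
          Real.exp (-(z.1 ^ 2 + z.2 ^ 2) / ħ) := by
      ext z
      ring
    rw [e]
    refine ⟨i1.add i2, ?_⟩
    rw [integral_add i1 i2, e1, e2]
    have hp : (ascPochhammer ℝ (n + 1)).eval ((α : ℝ) + β + 1) =
        ((α : ℝ) + β + 1) * (ascPochhammer ℝ n).eval ((α : ℝ) + β + 1 + 1) := by
      rw [ascPochhammer_succ_left]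
      simp [Polynomial.eval_comp]
    rw [hp]
    push_cast
    rw [show (α : ℝ) + 1 + β + 1 = (α : ℝ) + β + 1 + 1 by ring,
      show (α : ℝ) + (β + 1) + 1 = (α : ℝ) + β + 1 + 1 by ring]
    linear_combination ((ascPochhammer ℝ n).eval ((α : ℝ) + β + 1 + 1) * ħ ^ n) *
      gaussianMoment_succ_add ħ α β

end Moments

/-! ### The terminating hypergeometric series and the conclusion -/

/-- Since `(-k)_n = (-1)^n n! C(k,n)` and `(1)_n = n!`, one `n!` survives in the denominator, and
the terms vanish for `n > k`. -/
theorem ordinaryHypergeometric_neg_nat_one (a x : ℝ) (k : ℕ) :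
    ₂F₁ a (-(k : ℝ)) (1 : ℝ) x = ∑ n ∈ Finset.range (k + 1),
      (k.choose n : ℝ) / n.factorial * (ascPochhammer ℝ n).eval a * (-x) ^ n := by
  rw [ordinaryHypergeometric_eq_tsum]
  dsimp only
  rw [tsum_eq_sum (s := Finset.range (k + 1))]
  · refine Finset.sum_congr rfl fun n _ => ?_
    rw [ascPochhammer_eval_neg_eq_descPochhammer, descPochhammer_eval_eq_descFactorial,
      ← Nat.cast_factorial, Nat.descFactorial_eq_factorial_mul_choose, smul_eq_mul, neg_pow x]
    push_cast
    field_simp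
  · intro n hn
    have hn : k < n := by rw [Finset.mem_range] at hn; omega
    rw [ascPochhammer_eval_neg_coe_nat_of_lt hn]
    simp

theorem mainTheorem9 (ħ : ℝ) (hħ : 0 < ħ) (α β k : ℕ) :
    Integrable (fun z : ℝ × ℝ =>
      (z.1 : ℂ) ^ (2 * α) * (z.2 : ℂ) ^ (2 * β) * wigner ħ (hermiteFunction ħ k) z) ∧
    ∫ z : ℝ × ℝ,
        (z.1 : ℂ) ^ (2 * α) * (z.2 : ℂ) ^ (2 * β) * wigner ħ (hermiteFunction ħ k) z =
      ((₂F₁ ((α : ℝ) + β + 1) (-(k : ℝ)) (1 : ℝ) (2 : ℝ) * (-1) ^ k *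
        (ħ ^ (α + β) * ((2 * α).factorial : ℝ) * ((2 * β).factorial : ℝ) /
          (4 ^ (α + β) * (α.factorial : ℝ) * (β.factorial : ℝ))) : ℝ) : ℂ) := by
  have e : (fun z : ℝ × ℝ =>
      (z.1 : ℂ) ^ (2 * α) * (z.2 : ℂ) ^ (2 * β) * wigner ħ (hermiteFunction ħ k) z) =
      fun z : ℝ × ℝ => ((∑ n ∈ Finset.range (k + 1),
        ((-1) ^ k / (Real.pi * ħ) * ((k.choose n : ℝ) / n.factorial * (-2 / ħ) ^ n)) *
        (z.1 ^ (2 * α) * z.2 ^ (2 * β) * (z.1 ^ 2 + z.2 ^ 2) ^ n *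
          Real.exp (-(z.1 ^ 2 + z.2 ^ 2) / ħ)) : ℝ) : ℂ) := by
    ext z
    rw [wigner_hermiteFunction ħ hħ, ← Complex.ofReal_pow, ← Complex.ofReal_pow,
      ← Complex.ofReal_mul, ← Complex.ofReal_mul, Finset.mul_sum, Finset.mul_sum]
    congr 1
    refine Finset.sum_congr rfl fun n _ => ?_
    rw [show -2 * (z.1 ^ 2 + z.2 ^ 2) / ħ = -2 / ħ * (z.1 ^ 2 + z.2 ^ 2) by ring, mul_pow]
    ring
  have hI := fun n => (integral_monomial_mul_radial_gaussian ħ hħ n α β).1.const_mul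
    ((-1) ^ k / (Real.pi * ħ) * ((k.choose n : ℝ) / n.factorial * (-2 / ħ) ^ n))
  rw [e]
  have hS := integrable_finsetSum (Finset.range (k + 1)) fun n _ => hI n
  refine ⟨hS.ofReal (𝕜 := ℂ), ?_⟩
  rw [integral_complex_ofReal, integral_finsetSum _ fun n _ => hI n, ordinaryHypergeometric_neg_nat_one,
    Finset.sum_mul, Finset.sum_mul]
  congr 1
  refine Finset.sum_congr rfl fun n _ => ?_
  -- The `ħ^n` of the moment cancels that in `(-2/ħ)^n`, leaving argument 2, and its `πħ` cancels
  -- the Wigner prefactor.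
  rw [integral_const_mul, (integral_monomial_mul_radial_gaussian ħ hħ n α β).2, gaussianMoment,
    div_pow]
  have := Real.pi_ne_zero
  field_simp
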